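/- Let $d\ge 3$. A ($d$-dimensional) copula is a function $C:[0,1]^d\to[0,1]$ of the form $C(\mathbf x)=\mu_C([0,x_1]\times\cdots\times[0,x_d])$, where $\mu_C$ (its $d$-stochastic measure) is a probability measure on $[0,1]^d$ whose one-dimensional marginals are all uniform. An (Archimedean) generator is a continuous non-increasing function $\psi:[0,\infty)\to[0,1]$ with $\psi(0)=1$ and $\lim_{z\to\infty}\psi(z)=0=:\psi(\infty)$ which is strictly decreasing on $[0,\inf\{z\in[0,\infty]:\psi(z)=0\}]$. Its pseudo-inverse $\varphi:[0,1]\to[0,\infty]$ is $\varphi(y)=\inf\{z\in[0,\infty]:\psi(z)=y\}$, and $\psi$ is called strict if $\varphi(0)=\infty$, non-strict otherwise. Let $D^-g$ denote the left-hand derivative of $g$. Let $C$ be a copula and $\psi$ a generator such that $C(\mathbf x)=\psi(\varphi(x_1)+\cdots+\varphi(x_d))$ for all $\mathbf x\in[0,1]^d$ (that is, $C$ is Archimedean with generator $\psi$; $C$ is called strict if $\psi$ is). Write $L_t=\{\mathbf x\in[0,1]^d: C(\mathbf x)=t\}$ for the level sets of $C$ and $F_K^d(t)=\mu_C(\{\mathbf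 x: C(\mathbf x)\le t\})$ for its Kendall distribution function. Then $\psi$ is $(d-2)$ times continuously differentiable on $(0,\infty)$, $D^-\psi^{(d-2)}(z)$ exists for every $z>0$, $\varphi(t)<\infty$ for every $t\in(0,1]$, for every $t\in(0,1)$ the limit $$D^-\psi^{(d-2)}(\varphi(t-)):=\lim_{s\uparrow t}D^-\psi^{(d-2)}(\varphi(s))$$ exists in $\mathbb R$, and the following hold. (1) For every $t\in(0,1]$, $$\mu_C(L_t)=\frac{(-\varphi(t))^{d-1}}{(d-1)!}\Big(D^-\psi^{(d-2)}(\varphi(t))-D^-\psi^{(d-2)}(\varphi(t-))\Big).$$ If $C$ is strict, then $\mu_C(L_0)=0$; if $C$ is non-strict, then $$\mu_C(L_0)=\frac{(-\varphi(0))^{d-1}}{(d-1)!}\,D^-\psi^{(d-2)}(\varphi(0)).$$ (2) For every $t\in(0,1]$, $$F_K^d(t)=D^-\psi^{(d-2)}(\varphi(t))\,\frac{(-1)^{d-1}}{(d-1)!}\,\varphi(t)^{d-1}+\sum_{k=0}^{d-2}\psi^{(k)}(\varphi(t))\,\frac{(-1)^k}{k!}\,\varphi(t)^k .$$ If $C$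 is strict, then $F_K^d(0)=0$; if $C$ is non-strict, then $$F_K^d(0)=D^-\psi^{(d-2)}(\varphi(0))\,\frac{(-1)^{d-1}}{(d-1)!}\,\varphi(0)^{d-1}.$$ At $t=1$, where $\varphi(1)=0$, every term that contains a positive power of $\varphi(1)$ is read as $0$ (and $\varphi(1)^0=1$), so that the formulas say $\mu_C(L_1)=0$ and $F_K^d(1)=1$. -/

import Mathlib

open Set Filter Topology MeasureTheory
open scoped ENNReal

noncomputable section

/-- The extension of `ψ : [0,∞) → ℝ` to `[0,∞]` by `ψ(∞) = 0`. The values of `ψ : ℝ → ℝ` at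
negative arguments play no role. -/
def generatorExt (ψ : ℝ → ℝ) (z : ℝ≥0∞) : ℝ :=
  if z = ∞ then 0 else ψ z.toReal

/-- The pseudo-inverse `φ(y) = inf {z ∈ [0,∞] : ψ(z) = y}`, for `y ∈ [0,1]`. -/
def pseudoInv (ψ : ℝ → ℝ) (y : ℝ) : ℝ≥0∞ :=
  sInf {z : ℝ≥0∞ | generatorExt ψ z = y}

/-- `ψ` restricted to `[0,∞)` is an Archimedean generator: a continuous non-increasing function
`[0,∞) → [0,1]` with `ψ(0) = 1` and `ψ(z) → 0` as `z → ∞`, which (extended by `ψ(∞) = 0`) is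
strictly decreasing on `[0, inf {z ∈ [0,∞] : ψ(z) = 0}]`. -/
structure IsArchimedeanGenerator (ψ : ℝ → ℝ) : Prop where
  continuousOn : ContinuousOn ψ (Ici 0)
  antitoneOn : AntitoneOn ψ (Ici 0)
  mapsTo : MapsTo ψ (Ici 0) (Icc 0 1)
  map_zero : ψ 0 = 1
  tendsto_atTop : Tendsto ψ atTop (𝓝 0)
  strictAntiOn : StrictAntiOn (generatorExt ψ) (Icc 0 (sInf {z : ℝ≥0∞ | generatorExt ψ z = 0}))

/-- A generator is strict if `φ(0) = ∞`. -/
def IsStrictGenerator (ψ : ℝ → ℝ) : Prop :=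
  pseudoInv ψ 0 = ∞

/-- The function `C_ψ(x) = ψ(φ(x₁) + ⋯ + φ(x_d))` on the unit cube. -/
def archimedeanFun (d : ℕ) (ψ : ℝ → ℝ) (x : Fin d → unitInterval) : ℝ :=
  generatorExt ψ (∑ i, pseudoInv ψ (x i))

/-- `C` is a `d`-dimensional copula and `μ` is its `d`-stochastic measure: `μ` is a probability
measure on the unit cube with uniform one-dimensional marginals, and `C(x) = μ([0,x])`.
(`Set.Iic x` is the box `[0,x₁] × ⋯ × [0,x_d]`.) -/
structure IsCopulaWithMeasure {d : ℕ} (C : (Fin d → unitInterval) → ℝ)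
    (μ : Measure (Fin d → unitInterval)) : Prop where
  isProbabilityMeasure : IsProbabilityMeasure μ
  map_eval : ∀ i, μ.map (fun x => x i) = (volume : Measure unitInterval)
  real_Iic : ∀ x, μ.real (Iic x) = C x

/-- The level set `L_t = {x : C(x) = t}`. -/
def levelSet {d : ℕ} (C : (Fin d → unitInterval) → ℝ) (t : ℝ) : Set (Fin d → unitInterval) :=
  {x | C x = t}

/-- The Kendall distribution function `F_K(t) = μ({x : C(x) ≤ t})`, the distribution function of
`C(X)` for `X` with distribution `μ`. -/
def kendallFun {d : ℕ} (C : (Fin d → unitInterval) → ℝ) (μ : Measure (Fin d → unitInterval))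
    (t : ℝ) : ℝ :=
  μ.real {x | C x ≤ t}

/-- The left-hand derivative `D⁻g(z)`. -/
def leftDeriv (g : ℝ → ℝ) (z : ℝ) : ℝ :=
  derivWithin g (Iio z) z

end

/-! Let `X` have law `μ`, put `Z i = φ(X i)` and `S = ∑ i, Z i`. Almost surely `C(X) = ψ(S)`, so for
`0 < t < 1` both claims concern the law of `S`: up to null sets `L_t` is `{S = φ(t)}` and `{C ≤ t}`
is `{φ(t) ≤ S}`.

The copula identity says `P(Z ≥ a) = ψ(∑ i, a i)`, which forces `ψ` to be the Williamson transform
of `S`, namely `ψ(z) = E[(1 - z/S)_+ ^ (d-1)]` (`eq_integral_williamson`). No smoothness of `ψ` is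
assumed for this. On a grid of mesh `h`, the mass of a cell depends only on the sum of its integer
indices, so given that sum the index vector is uniform on the tuples with that sum. Stars and bars
gives the conditional tail of one index, and `h → 0` gives the transform.

Differentiating under the expectation, each derivative lowers the power of `(1 - z/S)_+` by one and
produces a factor `-1/S`. The last, one-sided derivative is `(-1)^(d-1) (d-1)! E[1_{z ≤ S} /
S^(d-1)]`: its jump at `z` is the atom of `S` there, up to a factor. The Kendall formula is the
expectation, on `{z ≤ S}`, of the binomial expansion of `1 = (z/S + (1 - z/S))^(d-1)`. -/

/-! ### Counting tuples with a given sum. -/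

/-- The stars and bars count of the tuples of natural numbers with a given sum. -/
theorem card_piAntidiag_univ_fin (n m : ℕ) :
    (Finset.univ.piAntidiag m : Finset (Fin (n + 1) → ℕ)).card = (n + m).choose n := by
  have e : (Finset.univ.piAntidiag m : Finset (Fin (n + 1) → ℕ)) ≃ Sym (Fin (n + 1)) m :=
    (Equiv.subtypeEquivRight fun x => by simp).trans (Sym.equivNatSumOfFintype _ m).symm
  rw [← Fintype.card_coe, Fintype.card_congr e, Sym.card_sym_eq_choose, Fintype.card_fin,
    show n + 1 + m - 1 = n + m by omega, ← Nat.choose_symm_add]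

/-- The number of tuples with sum `m` whose first entry is at least `k ≤ m`. -/
theorem card_filter_piAntidiag_le (n : ℕ) {k m : ℕ} (hkm : k ≤ m) :
    ((Finset.univ.piAntidiag m : Finset (Fin (n + 1) → ℕ)).filter (fun v => k ≤ v 0)).card =
      (n + (m - k)).choose n := by
  rw [← card_piAntidiag_univ_fin]
  -- Subtracting `k` from the first entry is a bijection onto the tuples with sum `m - k`.
  refine Finset.card_bij' (fun v _ => Function.update v 0 (v 0 - k))
    (fun v _ => Function.update v 0 (v 0 + k)) ?_ ?_ ?_ ?_
  · intro v hv
    simp only [Finset.mem_filter, Finset.mem_piAntidiag, Finset.mem_univ, implies_true,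
      and_true, Fin.sum_univ_succ] at hv ⊢
    simp only [Function.update_self, ne_eq, Fin.succ_ne_zero, not_false_eq_true,
      Function.update_of_ne]
    omega
  · intro v hv
    simp only [Finset.mem_filter, Finset.mem_piAntidiag, Finset.mem_univ, implies_true,
      and_true, Fin.sum_univ_succ] at hv ⊢
    simp only [Function.update_self, ne_eq, Fin.succ_ne_zero, not_false_eq_true,
      Function.update_of_ne]
    omega
  · intro v hv
    simp only [Finset.mem_filter] at hv
    simp [Nat.sub_add_cancel hv.2]
  · intro v hv
    simp

/-- Among the tuples of `n + 1` natural numbers with sum `m`, the fraction of those whose first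
entry is at least `k`. -/
theorem card_filter_piAntidiag_eq_prod_mul {n : ℕ} (hn : 0 < n) (k m : ℕ) :
    (((Finset.univ.piAntidiag m : Finset (Fin (n + 1) → ℕ)).filter
      (fun v => k ≤ v 0)).card : ℝ) =
      (∏ j ∈ Finset.range n, max 0 (1 - (k : ℝ) / (m + 1 + j))) *
        (Finset.univ.piAntidiag m : Finset (Fin (n + 1) → ℕ)).card := by
  rcases le_or_gt k m with h | h
  · rw [card_filter_piAntidiag_le n h, card_piAntidiag_univ_fin]
    -- Times `n!`, both binomials become rising products, at `l = m - k` and `l = m`, whose ratio is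
    -- taken factor by factor.
    have key : ∀ l : ℕ, (n.factorial : ℝ) * ((n + l).choose n : ℕ) =
        ∏ j ∈ Finset.range n, ((l : ℝ) + 1 + j) := by
      intro l
      have := Nat.ascFactorial_eq_factorial_mul_choose l n
      rw [Nat.ascFactorial_eq_prod_range, add_comm l n] at this
      exact_mod_cast this.symm
    have hf : (n.factorial : ℝ) ≠ 0 := by positivity
    apply mul_left_cancel₀ hf
    rw [key, mul_left_comm, key, ← Finset.prod_mul_distrib]
    refine Finset.prod_congr rfl fun j _ => ?_
    have hk : (k : ℝ) ≤ m := by exact_mod_cast h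
    have hpos : (0 : ℝ) < m + 1 + j := by positivity
    rw [max_eq_right]
    · rw [Nat.cast_sub h]
      field_simp
      ring
    · rw [sub_nonneg, div_le_one hpos]
      have : (0 : ℝ) ≤ j := by positivity
      linarith
  -- For `m < k` the factor `j = 0` is already zero; it is present because `0 < n`.
  · rw [Finset.filter_eq_empty_iff.2, Finset.card_empty, Finset.prod_eq_zero (Finset.mem_range.2 hn)]
    · simp
    · rw [max_eq_left]
      rw [sub_nonpos, le_div_iff₀ (by positivity)]
      push_cast
      have : (m : ℝ) + 1 ≤ k := by exact_mod_cast h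
      linarith
    · intro v hv hk
      simp only [Finset.mem_piAntidiag, Finset.mem_univ, implies_true, and_true] at hv
      have := Finset.single_le_sum (f := v) (fun i _ => Nat.zero_le _) (Finset.mem_univ 0)
      rw [hv] at this
      omega

/-! ### From the joint survival function to the Williamson transform. -/

/-- The `j`-fold backward difference `Σ_i (-1)^i C(j,i) ψ(s + i h)`. -/
noncomputable def iteratedBwdDiff (ψ : ℝ → ℝ) (h : ℝ) : ℕ → ℝ → ℝ
  | 0, s => ψ s
  | j + 1, s => iteratedBwdDiff ψ h j s - iteratedBwdDiff ψ h j (s + h)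

section Survival

variable {Ω : Type*} [MeasurableSpace Ω] {μ : Measure Ω} [IsProbabilityMeasure μ]
  {n : ℕ} {Z : Ω → Fin (n + 1) → ℝ} {ψ : ℝ → ℝ}

/-- If the survival function of a random vector is a function of the sum of the coordinates, so is
the probability of a box with sides of length `h`. -/
theorem measureReal_box_eq_iteratedBwdDiff (hZ : Measurable Z)
    (hsurv : ∀ a : Fin (n + 1) → ℝ, (∀ i, 0 ≤ a i) →
      μ.real {ω | ∀ i, a i ≤ Z ω i} = ψ (∑ i, a i))
    {h : ℝ} (hh : 0 ≤ h) (T : Finset (Fin (n + 1))) :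
    ∀ a : Fin (n + 1) → ℝ, (∀ i, 0 ≤ a i) →
      μ.real {ω | (∀ i, a i ≤ Z ω i) ∧ ∀ i ∈ T, Z ω i < a i + h} =
        iteratedBwdDiff ψ h T.card (∑ i, a i) := by
  have hZi : ∀ i, Measurable fun ω => Z ω i := fun i => (measurable_pi_apply i).comp hZ
  induction T using Finset.induction_on with
  | empty => intro a ha; simpa [iteratedBwdDiff] using hsurv a ha
  | insert j T hj ih =>
    intro a ha
    rw [Finset.card_insert_of_notMem hj, iteratedBwdDiff, ← ih a ha]
    -- Imposing `Z j < a j + h` removes the same event with corner `b`, whose coordinate sum is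
    -- larger by `h`: one more backward difference.
    set b := Function.update a j (a j + h) with hb
    have hbj : b j = a j + h := by simp [hb]
    have hbi : ∀ i, i ≠ j → b i = a i := fun i hi => by simp [hb, hi]
    have hb0 : ∀ i, 0 ≤ b i := by
      intro i
      rcases eq_or_ne i j with rfl | hi
      · rw [hbj]; linarith [ha i]
      · rw [hbi i hi]; exact ha i
    have hsum : ∑ i, b i = ∑ i, a i + h := by
      rw [← Finset.add_sum_erase _ _ (Finset.mem_univ j), hbj,
        ← Finset.add_sum_erase (a := j) _ a (Finset.mem_univ j),
        Finset.sum_congr rfl fun i hi => hbi i (Finset.ne_of_mem_erase hi)]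
      ring
    have hab : ∀ i, a i ≤ b i := by
      intro i
      rcases eq_or_ne i j with rfl | hi
      · rw [hbj]; linarith
      · rw [hbi i hi]
    rw [← hsum, ← ih b hb0, ← measureReal_sdiff]
    · congr 1
      ext ω
      simp only [mem_ofPred_eq, Set.mem_sdiff, Finset.mem_insert, forall_eq_or_imp, not_and, not_forall, exists_prop,
        not_lt]
      constructor
      · rintro ⟨h1, h2, h3⟩
        exact ⟨⟨h1, h3⟩, fun h4 => absurd (h4 j) (by rw [hbj]; exact not_le.2 h2)⟩
      · rintro ⟨⟨h1, h2⟩, h3⟩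
        refine ⟨h1, ?_, h2⟩
        by_contra! hc
        obtain ⟨i, hi, h4⟩ := h3 fun i => by
          rcases eq_or_ne i j with rfl | hi
          · rwa [hbj]
          · rw [hbi i hi]; exact h1 i
        rw [hbi i (ne_of_mem_of_not_mem hi hj)] at h4
        exact absurd (h2 i hi) (not_lt.2 h4)
    · rintro ω ⟨h1, h2⟩
      refine ⟨fun i => (hab i).trans (h1 i), fun i hi => ?_⟩
      have := h2 i hi
      rwa [hbi i (ne_of_mem_of_not_mem hi hj)] at this
    · simp only [ofPred_and, ofPred_forall]
      refine (MeasurableSet.iInter fun i => measurableSet_le measurable_const (hZi i)).inter ?_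
      exact MeasurableSet.iInter fun i => MeasurableSet.iInter fun _ =>
        measurableSet_lt (hZi i) measurable_const

/-- The probability that `⌊Z / h⌋` takes a given value depends only on the sum of the coordinates
of that value. -/
theorem measureReal_floor_eq (hZ : Measurable Z) (hZ0 : ∀ ω i, 0 ≤ Z ω i)
    (hsurv : ∀ a : Fin (n + 1) → ℝ, (∀ i, 0 ≤ a i) →
      μ.real {ω | ∀ i, a i ≤ Z ω i} = ψ (∑ i, a i))
    {h : ℝ} (hh : 0 < h) (v : Fin (n + 1) → ℕ) :
    μ.real {ω | (fun i => ⌊Z ω i / h⌋₊) = v} =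
      iteratedBwdDiff ψ h (n + 1) (h * (∑ i, v i : ℕ)) := by
  have := measureReal_box_eq_iteratedBwdDiff hZ hsurv hh.le Finset.univ (fun i => h * v i)
    (fun i => by positivity)
  rw [Finset.card_univ, Fintype.card_fin, ← Finset.mul_sum] at this
  push_cast
  rw [← this]
  congr 1
  ext ω
  simp only [mem_ofPred_eq, Finset.mem_univ, true_imp_iff, ← forall_and, funext_iff]
  refine forall_congr' fun i => ?_
  rw [Nat.floor_eq_iff (div_nonneg (hZ0 ω i) hh.le), le_div_iff₀ hh, div_lt_iff₀ hh]
  constructor <;> rintro ⟨h1, h2⟩ <;> constructor <;> linarith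

/-- The discretized Williamson transform. -/
theorem measureReal_le_floor_eq_integral (hn : 0 < n) (hZ : Measurable Z)
    (hZ0 : ∀ ω i, 0 ≤ Z ω i)
    (hsurv : ∀ a : Fin (n + 1) → ℝ, (∀ i, 0 ≤ a i) →
      μ.real {ω | ∀ i, a i ≤ Z ω i} = ψ (∑ i, a i))
    {h : ℝ} (hh : 0 < h) (k : ℕ) :
    μ.real {ω | k ≤ ⌊Z ω 0 / h⌋₊} =
      ∫ ω, ∏ j ∈ Finset.range n,
        max 0 (1 - (k : ℝ) / ((∑ i, ⌊Z ω i / h⌋₊ : ℕ) + 1 + j)) ∂μ := by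
  set N : Ω → Fin (n + 1) → ℕ := fun ω i => ⌊Z ω i / h⌋₊ with hN
  have hZi : ∀ i, Measurable fun ω => Z ω i := fun i => (measurable_pi_apply i).comp hZ
  have hNm : Measurable N := measurable_pi_lambda _ fun i =>
    Nat.measurable_floor.comp ((hZi i).div_const h)
  set r : ℕ → ℝ := fun m => ∏ j ∈ Finset.range n, max 0 (1 - (k : ℝ) / ((m : ℝ) + 1 + j)) with hr
  have hr0 : ∀ m, 0 ≤ r m := fun m => Finset.prod_nonneg fun _ _ => le_max_left _ _
  have hr1 : ∀ m, r m ≤ 1 := fun m => Finset.prod_le_one (fun _ _ => le_max_left _ _)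
    fun j _ => max_le zero_le_one (sub_le_self _ (by positivity))
  set M : Ω → ℕ := fun ω => ∑ i, N ω i with hM
  have hMm : Measurable M := by
    have : Measurable fun v : Fin (n + 1) → ℕ => ∑ i, v i := measurable_of_countable _
    exact this.comp hNm
  have hAm : MeasurableSet {ω | k ≤ N ω 0} :=
    measurableSet_le measurable_const ((measurable_pi_apply 0).comp hNm)
  have hrint : Integrable (fun ω => r (M ω)) μ :=
    Integrable.of_bound ((measurable_of_countable r).comp hMm).aestronglyMeasurable 1
      (ae_of_all _ fun ω => by rw [Real.norm_of_nonneg (hr0 _)]; exact hr1 _)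
  have hiint : Integrable ({ω | k ≤ N ω 0}.indicator (fun _ => (1 : ℝ))) μ :=
    (integrable_const 1).indicator hAm
  have hBm : ∀ m, MeasurableSet (M ⁻¹' {m}) := fun m => hMm (measurableSet_singleton m)
  -- All cells with index sum `m` have the same mass, so on that fibre probabilities are counts
  -- times this mass.
  have hpre : ∀ (p : (Fin (n + 1) → ℕ) → Prop) [DecidablePred p] (m : ℕ),
      μ.real ({ω | p (N ω)} ∩ M ⁻¹' {m}) =
        ((Finset.univ.piAntidiag m : Finset (Fin (n + 1) → ℕ)).filter p).card *
          iteratedBwdDiff ψ h (n + 1) (h * m) := by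
    intro p _ m
    have : {ω | p (N ω)} ∩ M ⁻¹' {m} =
        ⋃ v ∈ (Finset.univ.piAntidiag m : Finset (Fin (n + 1) → ℕ)).filter p, {ω | N ω = v} := by
      ext ω
      simp [hM, and_comm]
    rw [this, measureReal_biUnion_finset]
    · rw [Finset.sum_congr rfl (g := fun _ => iteratedBwdDiff ψ h (n + 1) (h * m)), Finset.sum_const,
        nsmul_eq_mul]
      intro v hv
      rw [measureReal_floor_eq hZ hZ0 hsurv hh]
      simp only [Finset.mem_filter, Finset.mem_piAntidiag] at hv
      rw [hv.1.1]
    · intro v _ w _ hvw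
      exact Set.disjoint_left.2 fun ω h1 h2 => hvw (h1.symm.trans h2)
    · exact fun v _ => hNm (measurableSet_singleton v)
  -- The two integrands have equal integrals over every fibre of `M`; the countably many fibres are
  -- then summed.
  have hfib : ∀ m, ∫ ω in M ⁻¹' {m},
      ({ω | k ≤ N ω 0}.indicator (fun _ => (1 : ℝ)) ω - r (M ω)) ∂μ = 0 := by
    intro m
    rw [integral_sub hiint.integrableOn hrint.integrableOn,
      setIntegral_congr_fun (f := fun ω => r (M ω)) (g := fun _ => r m) (hBm m) (fun ω hω => by
        simp only [mem_preimage, mem_singleton_iff] at hω; simp [hω]),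
      integral_indicator hAm, Measure.restrict_restrict hAm]
    simp only [integral_const, MeasurableSet.univ, measureReal_restrict_apply, univ_inter,
      smul_eq_mul, mul_one]
    have h1 := hpre (fun v => k ≤ v 0) m
    have h2 := hpre (fun _ => True) m
    simp only [ofPred_true, univ_inter, Finset.filter_true] at h2
    rw [h1, h2, card_filter_piAntidiag_eq_prod_mul hn]
    ring
  have htot := integral_iUnion hBm (fun i j hij => Set.disjoint_left.2 fun ω h1 h2 =>
    hij (by simp only [mem_preimage, mem_singleton_iff] at h1 h2; omega))
    ((hiint.sub hrint).integrableOn (s := ⋃ m, M ⁻¹' {m}))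
  simp only [Pi.sub_apply, hfib, tsum_zero] at htot
  rw [show (⋃ m, M ⁻¹' {m}) = univ by ext; simp, Measure.restrict_univ,
    integral_sub hiint hrint, sub_eq_zero, integral_indicator_const _ hAm] at htot
  simpa [hr, hM, hN] using htot

/-- A function of the sum which is a survival function on the orthant is the Williamson transform
of the law of the sum. -/
theorem eq_integral_williamson (hn : 0 < n) (hZ : Measurable Z)
    (hZ0 : ∀ ω i, 0 ≤ Z ω i) (hS : ∀ᵐ ω ∂μ, 0 < ∑ i, Z ω i)
    (hsurv : ∀ a : Fin (n + 1) → ℝ, (∀ i, 0 ≤ a i) →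
      μ.real {ω | ∀ i, a i ≤ Z ω i} = ψ (∑ i, a i))
    {z : ℝ} (hz : 0 < z) :
    ψ z = ∫ ω, (max 0 (1 - z / ∑ i, Z ω i)) ^ n ∂μ := by
  have hZi : ∀ i, Measurable fun ω => Z ω i := fun i => (measurable_pi_apply i).comp hZ
  -- With mesh `z / (k + 1)` the event `k + 1 ≤ ⌊Z 0 / h⌋` is exactly `z ≤ Z 0`, so the left side
  -- does not depend on `k`.
  have hlhs : ∀ k : ℕ, ψ z = ∫ ω, ∏ j ∈ Finset.range n, max 0 (1 - ((k + 1 : ℕ) : ℝ) /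
      ((∑ i, ⌊Z ω i / (z / ((k + 1 : ℕ) : ℝ))⌋₊ : ℕ) + 1 + j)) ∂μ := by
    intro k
    have hk : (0 : ℝ) < ((k + 1 : ℕ) : ℝ) := by positivity
    rw [← measureReal_le_floor_eq_integral hn hZ hZ0 hsurv (div_pos hz hk)]
    have := hsurv (Pi.single 0 z) (fun i => by
      rcases eq_or_ne i 0 with rfl | hi
      · simpa using hz.le
      · simp [hi])
    rw [Finset.sum_pi_single'] at this
    simp only [Finset.mem_univ, if_true] at this
    rw [← this]
    congr 1
    ext ω
    simp only [mem_ofPred_eq]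
    rw [Nat.le_floor_iff (div_nonneg (hZ0 ω 0) (by positivity)), div_div_eq_mul_div,
      le_div_iff₀ hz, mul_comm, mul_le_mul_iff_left₀ hk]
    constructor
    · intro h; simpa using h 0
    · intro h i
      rcases eq_or_ne i 0 with rfl | hi
      · simpa using h
      · simpa [hi] using hZ0 ω i
  refine tendsto_nhds_unique (l := atTop) (tendsto_const_nhds.congr hlhs) ?_
  refine tendsto_integral_filter_of_dominated_convergence (fun _ => 1) ?_ ?_ (integrable_const 1) ?_
  · refine Eventually.of_forall fun k => Measurable.aestronglyMeasurable ?_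
    refine Finset.measurable_prod _ fun j _ => measurable_const.max (measurable_const.sub
      (measurable_const.div (((measurable_from_nat (f := fun m : ℕ => (m : ℝ))).comp ?_ |>.add_const _).add_const _)))
    exact Finset.measurable_sum _ fun i _ => Nat.measurable_floor.comp ((hZi i).div_const _)
  · refine Eventually.of_forall fun k => ae_of_all _ fun ω => ?_
    rw [Real.norm_of_nonneg (Finset.prod_nonneg fun _ _ => le_max_left _ _)]
    exact Finset.prod_le_one (fun _ _ => le_max_left _ _)
      fun j _ => max_le zero_le_one (sub_le_self _ (by positivity))
  · filter_upwards [hS] with ω hω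
    have hlim : ∀ j : ℕ, Tendsto (fun k : ℕ => max 0 (1 - ((k + 1 : ℕ) : ℝ) /
        ((∑ i, ⌊Z ω i / (z / ((k + 1 : ℕ) : ℝ))⌋₊ : ℕ) + 1 + j))) atTop
        (𝓝 (max 0 (1 - z / ∑ i, Z ω i))) := by
      intro j
      have hcast : Tendsto (fun k : ℕ => ((k + 1 : ℕ) : ℝ)) atTop atTop :=
        tendsto_natCast_atTop_atTop.comp (tendsto_add_atTop_nat 1)
      have h1 : ∀ i, Tendsto (fun k : ℕ => (⌊Z ω i / (z / ((k + 1 : ℕ) : ℝ))⌋₊ : ℝ) /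
          ((k + 1 : ℕ) : ℝ)) atTop (𝓝 (Z ω i / z)) := by
        intro i
        refine ((tendsto_nat_floor_mul_div_atTop (div_nonneg (hZ0 ω i) hz.le)).comp hcast).congr
          fun k => ?_
        simp only [Function.comp_apply]
        rw [div_div_eq_mul_div, div_mul_eq_mul_div]
      have h2 : Tendsto (fun k : ℕ => (1 + j : ℝ) / ((k + 1 : ℕ) : ℝ)) atTop (𝓝 0) :=
        tendsto_const_nhds.div_atTop hcast
      -- Inverting the limit needs `S ≠ 0`, whence the hypothesis that `S` is almost surely
      -- positive.
      have h3 := ((tendsto_finsetSum Finset.univ fun i _ => h1 i).add h2).inv₀ (by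
        rw [← Finset.sum_div, add_zero]; exact (div_pos hω hz).ne')
      rw [← Finset.sum_div, add_zero, inv_div] at h3
      refine tendsto_const_nhds.max (tendsto_const_nhds.sub (h3.congr fun k => ?_))
      rw [← Finset.sum_div, ← add_div, inv_div]
      push_cast
      rw [add_assoc]
    simpa using tendsto_finsetProd (Finset.range n) fun j _ => hlim j

end Survival

/-! ### Truncated powers and the Williamson kernel. -/

/-- The truncated power `x ↦ x ^ m` for `0 ≤ x`, and `0` for `x < 0`. -/
noncomputable def truncPow (m : ℕ) (x : ℝ) : ℝ :=
  if 0 ≤ x then x ^ m else 0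

theorem truncPow_succ_eq (m : ℕ) (x : ℝ) : truncPow (m + 1) x = (max 0 x) ^ (m + 1) := by
  rw [truncPow]
  split_ifs with h
  · rw [max_eq_right h]
  · rw [max_eq_left (not_le.1 h).le, zero_pow m.succ_ne_zero]

theorem truncPow_nonneg (m : ℕ) (x : ℝ) : 0 ≤ truncPow m x := by
  rw [truncPow]
  split_ifs with h
  · positivity
  · rfl

theorem truncPow_le_one (m : ℕ) {x : ℝ} (hx : x ≤ 1) : truncPow m x ≤ 1 := by
  rw [truncPow]
  split_ifs with h
  · exact pow_le_one₀ h hx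
  · exact zero_le_one

theorem measurable_truncPow (m : ℕ) : Measurable (truncPow m) :=
  Measurable.ite measurableSet_Ici (measurable_id.pow_const m) measurable_const

theorem continuous_truncPow_succ (m : ℕ) : Continuous (truncPow (m + 1)) := by
  rw [funext (truncPow_succ_eq m)]
  fun_prop

/-- As `0 ^ 0 = 1`, `truncPow 0` is the indicator of `[0, ∞)`, the correct right derivative even at
the kink of `truncPow 1`. The decreasing substitution `w ↦ 1 - w / s` turns it into a left
derivative in `w`. -/
theorem hasDerivWithinAt_truncPow_Ioi (m : ℕ) (x : ℝ) :
    HasDerivWithinAt (truncPow (m + 1)) ((m + 1) * truncPow m x) (Ioi x) x := by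
  rcases le_or_gt 0 x with h | h
  · have h1 := (hasDerivAt_pow (m + 1) x).hasDerivWithinAt (s := Ioi x)
    rw [truncPow, if_pos h]
    refine (h1.congr (fun y hy => ?_) ?_).congr_deriv ?_
    · rw [truncPow, if_pos (h.trans (le_of_lt hy))]
    · rw [truncPow, if_pos h]
    · simp
  · rw [truncPow, if_neg (not_le.2 h), mul_zero]
    refine ((hasDerivAt_const x (0 : ℝ)).congr_of_eventuallyEq ?_).hasDerivWithinAt
    filter_upwards [Iio_mem_nhds h] with y hy
    rw [truncPow, if_neg (not_le.2 hy)]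

theorem hasDerivAt_truncPow (m : ℕ) (x : ℝ) :
    HasDerivAt (truncPow (m + 2)) ((m + 2) * truncPow (m + 1) x) x := by
  have hr := hasDerivWithinAt_truncPow_Ioi (m + 1) x
  have hl : HasDerivWithinAt (truncPow (m + 2)) ((m + 2) * truncPow (m + 1) x) (Iio x) x := by
    rcases lt_or_ge 0 x with h | h
    · refine ((hasDerivAt_pow (m + 2) x).congr_of_eventuallyEq ?_).hasDerivWithinAt.congr_deriv ?_
      · filter_upwards [Ioi_mem_nhds h] with y hy
        rw [truncPow, if_pos (le_of_lt hy)]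
      · rw [truncPow, if_pos h.le]; simp
    · have hz : ∀ k, ∀ y ≤ 0, truncPow (k + 1) y = 0 := by
        intro k y hy
        rw [truncPow_succ_eq, max_eq_left hy, zero_pow k.succ_ne_zero]
      rw [hz m x h, mul_zero]
      exact (hasDerivWithinAt_const x (Iio x) (0 : ℝ)).congr
        (fun y hy => hz (m + 1) y ((le_of_lt hy).trans h)) (hz (m + 1) x h)
  have hr' : HasDerivWithinAt (truncPow (m + 2)) ((m + 2) * truncPow (m + 1) x) (Ioi x) x := by
    refine hr.congr_deriv ?_
    push_cast
    ring
  have := (hl.Iic_of_Iio).union (hr'.Ici_of_Ioi)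
  rwa [Iic_union_Ici, hasDerivWithinAt_univ] at this

theorem abs_truncPow_succ_sub_le (m : ℕ) {x y : ℝ} (hx : x ≤ 1) (hy : y ≤ 1) :
    |truncPow (m + 1) x - truncPow (m + 1) y| ≤ (m + 1) * |x - y| := by
  rw [truncPow_succ_eq, truncPow_succ_eq]
  refine (abs_pow_sub_pow_le _ _ _).trans ?_
  have h1 : max |max 0 x| |max 0 y| ^ (m + 1 - 1) ≤ 1 := by
    refine pow_le_one₀ (le_max_of_le_left (abs_nonneg _)) (max_le ?_ ?_)
    · rw [abs_of_nonneg (le_max_left _ _)]; exact max_le zero_le_one hx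
    · rw [abs_of_nonneg (le_max_left _ _)]; exact max_le zero_le_one hy
  have h2 : |max 0 x - max 0 y| ≤ |x - y| := by
    rw [max_comm 0 x, max_comm 0 y]; exact abs_max_sub_max_le_abs x y 0
  calc |max 0 x - max 0 y| * ((m + 1 : ℕ) : ℝ) * max |max 0 x| |max 0 y| ^ (m + 1 - 1)
      ≤ |max 0 x - max 0 y| * ((m + 1 : ℕ) : ℝ) * 1 := by gcongr
    _ ≤ |x - y| * ((m + 1 : ℕ) : ℝ) * 1 := by gcongr
    _ = (m + 1) * |x - y| := by push_cast; ring

/-- The kernel `(1 - z / s)_+ ^ m / s ^ j`. -/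
noncomputable def williamsonKernel (m j : ℕ) (z s : ℝ) : ℝ :=
  truncPow m (1 - z / s) / s ^ j

theorem measurable_williamsonKernel (m j : ℕ) (z : ℝ) : Measurable (williamsonKernel m j z) :=
  ((measurable_truncPow m).comp (measurable_const.sub (measurable_const.div measurable_id))).div
    (measurable_id.pow_const j)

theorem williamsonKernel_of_lt {m j : ℕ} {z s : ℝ} (hs : 0 < s) (h : s < z) :
    williamsonKernel m j z s = 0 := by
  rw [williamsonKernel, truncPow, if_neg, zero_div]
  rw [not_le, sub_neg, one_lt_div hs]
  exact h

theorem williamsonKernel_of_le {m j : ℕ} {z s : ℝ} (hs : 0 < s) (h : z ≤ s) :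
    williamsonKernel m j z s = (1 - z / s) ^ m / s ^ j := by
  rw [williamsonKernel, truncPow, if_pos]
  rw [sub_nonneg, div_le_one hs]
  exact h

/-- The kernel vanishes for `s < z`, so the singularity of `1 / s ^ j` at zero is never met. This
uniform bound dominates the integrals below. -/
theorem abs_williamsonKernel_le (m j : ℕ) {z s : ℝ} (hz : 0 < z) (hs : 0 < s) :
    |williamsonKernel m j z s| ≤ (z ^ j)⁻¹ := by
  rcases lt_or_ge s z with h | h
  · rw [williamsonKernel_of_lt hs h, abs_zero]; positivity
  · rw [williamsonKernel, abs_of_nonneg (div_nonneg (truncPow_nonneg _ _) (by positivity)),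
      ← one_div]
    exact div_le_div₀ zero_le_one (truncPow_le_one m (sub_le_self _ (by positivity)))
      (by positivity) (pow_le_pow_left₀ hz.le h j)

theorem hasDerivAt_williamsonKernel (m j : ℕ) (z s : ℝ) :
    HasDerivAt (fun w => williamsonKernel (m + 2) j w s)
      (-(m + 2) * williamsonKernel (m + 1) (j + 1) z s) z := by
  have h1 : HasDerivAt (fun w : ℝ => 1 - w / s) (-(1 / s)) z :=
    ((hasDerivAt_id z).div_const s).const_sub 1
  refine (((hasDerivAt_truncPow m (1 - z / s)).comp z h1).div_const (s ^ j)).congr_deriv ?_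
  rw [williamsonKernel, pow_succ]
  simp only [div_eq_mul_inv, mul_inv]
  ring

theorem hasDerivWithinAt_williamsonKernel (m j : ℕ) {z s : ℝ} (hs : 0 < s) :
    HasDerivWithinAt (fun w => williamsonKernel (m + 1) j w s)
      (-(m + 1) * williamsonKernel m (j + 1) z s) (Iio z) z := by
  have h1 : HasDerivWithinAt (fun w : ℝ => 1 - w / s) (-(1 / s)) (Iio z) z :=
    (((hasDerivAt_id z).div_const s).const_sub 1).hasDerivWithinAt
  refine (((hasDerivWithinAt_truncPow_Ioi m (1 - z / s)).comp z h1 fun w hw => ?_).div_const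
    (s ^ j)).congr_deriv ?_
  · exact sub_lt_sub_left (div_lt_div_of_pos_right hw hs) 1
  · rw [williamsonKernel, pow_succ]
    simp only [div_eq_mul_inv, mul_inv]
    ring

/-- A Lipschitz bound for the difference quotients; it covers exponent one, where the kernel has a
kink. -/
theorem abs_williamsonKernel_sub_le (m j : ℕ) {a w z s : ℝ} (ha : 0 < a) (haw : a ≤ w)
    (haz : a ≤ z) (hs : 0 < s) :
    |williamsonKernel (m + 1) j w s - williamsonKernel (m + 1) j z s| ≤
      (m + 1) * (a ^ (j + 1))⁻¹ * |w - z| := by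
  rcases lt_or_ge s a with h | h
  · rw [williamsonKernel_of_lt hs (h.trans_le haw), williamsonKernel_of_lt hs (h.trans_le haz)]
    simp only [sub_self, abs_zero]
    positivity
  · have hw : 0 < w := ha.trans_le haw
    have hz : 0 < z := ha.trans_le haz
    rw [williamsonKernel, williamsonKernel, ← sub_div, abs_div, abs_of_pos (pow_pos hs j)]
    have h1 := abs_truncPow_succ_sub_le m (x := 1 - w / s) (y := 1 - z / s)
      (sub_le_self _ (by positivity)) (sub_le_self _ (by positivity))
    rw [sub_sub_sub_cancel_left, ← sub_div, abs_div, abs_of_pos hs, abs_sub_comm] at h1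
    rw [abs_sub_comm z w] at h1
    rw [abs_sub_comm]
    refine (div_le_div_of_nonneg_right h1 (by positivity)).trans ?_
    have h2 : (s ^ (j + 1))⁻¹ ≤ (a ^ (j + 1))⁻¹ :=
      inv_anti₀ (by positivity) (pow_le_pow_left₀ ha.le h _)
    calc (m + 1) * (|w - z| / s) / s ^ j = (m + 1) * (s ^ (j + 1))⁻¹ * |w - z| := by
          rw [pow_succ]; field_simp
      _ ≤ _ := by gcongr

/-! ### Differentiating Williamson integrals; atoms and tails. -/

section Integral

variable {Ω : Type*} [MeasurableSpace Ω] {μ : Measure Ω} [IsFiniteMeasure μ] {S : Ω → ℝ}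

theorem integrable_williamsonKernel (hS : Measurable S) (hS0 : ∀ᵐ ω ∂μ, 0 < S ω) (m j : ℕ) {z : ℝ}
    (hz : 0 < z) : Integrable (fun ω => williamsonKernel m j z (S ω)) μ :=
  Integrable.of_bound ((measurable_williamsonKernel m j z).comp hS).aestronglyMeasurable _
    (hS0.mono fun _ hω => abs_williamsonKernel_le m j hz hω)

theorem hasDerivAt_integral_williamsonKernel (hS : Measurable S) (hS0 : ∀ᵐ ω ∂μ, 0 < S ω)
    (m j : ℕ) {z : ℝ} (hz : 0 < z) :
    HasDerivAt (fun w => ∫ ω, williamsonKernel (m + 2) j w (S ω) ∂μ)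
      (-(m + 2) * ∫ ω, williamsonKernel (m + 1) (j + 1) z (S ω) ∂μ) z := by
  rw [← integral_const_mul]
  refine (hasDerivAt_integral_of_dominated_loc_of_deriv_le
    (F' := fun w ω => -(m + 2) * williamsonKernel (m + 1) (j + 1) w (S ω))
    (bound := fun _ => (m + 2) * ((z / 2) ^ (j + 1))⁻¹)
    (Ioi_mem_nhds (half_lt_self hz)) ?_ ?_ ?_ ?_ (integrable_const _) ?_).2
  · exact Eventually.of_forall fun w =>
      ((measurable_williamsonKernel _ j w).comp hS).aestronglyMeasurable
  · exact integrable_williamsonKernel hS hS0 _ _ hz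
  · exact (((measurable_williamsonKernel _ _ z).comp hS).const_mul _).aestronglyMeasurable
  · filter_upwards [hS0] with ω hω w hw
    have hw' : z / 2 < w := hw
    rw [norm_mul, norm_neg, Real.norm_of_nonneg (by positivity : (0 : ℝ) ≤ (m : ℝ) + 2)]
    refine mul_le_mul_of_nonneg_left ?_ (by positivity)
    refine (abs_williamsonKernel_le _ _ ((half_pos hz).trans hw') hω).trans ?_
    exact inv_anti₀ (by positivity) (pow_le_pow_left₀ (by positivity) hw'.le _)
  · exact ae_of_all _ fun ω w _ => hasDerivAt_williamsonKernel m j w (S ω)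

/-- At exponent one the kernel is only one-sidedly differentiable, so dominated convergence is
applied directly to the slopes. -/
theorem hasDerivWithinAt_integral_williamsonKernel (hS : Measurable S) (hS0 : ∀ᵐ ω ∂μ, 0 < S ω)
    (m j : ℕ) {z : ℝ} (hz : 0 < z) :
    HasDerivWithinAt (fun w => ∫ ω, williamsonKernel (m + 1) j w (S ω) ∂μ)
      (-(m + 1) * ∫ ω, williamsonKernel m (j + 1) z (S ω) ∂μ) (Iio z) z := by
  rw [← integral_const_mul, hasDerivWithinAt_iff_tendsto_slope' self_notMem_Iio]
  have hmem : ∀ᶠ w in 𝓝[<] z, z / 2 < w ∧ w < z :=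
    (eventually_nhdsWithin_of_eventually_nhds (Ioi_mem_nhds (half_lt_self hz))).and
      self_mem_nhdsWithin
  have hslope : ∀ᶠ w in 𝓝[<] z,
      ∫ ω, slope (fun w => williamsonKernel (m + 1) j w (S ω)) z w ∂μ =
        slope (fun w => ∫ ω, williamsonKernel (m + 1) j w (S ω) ∂μ) z w := by
    filter_upwards [hmem] with w hw
    simp only [slope_def_field]
    rw [integral_div, integral_sub
      (integrable_williamsonKernel hS hS0 _ _ ((half_pos hz).trans hw.1))
      (integrable_williamsonKernel hS hS0 _ _ hz)]
  refine Tendsto.congr' hslope ?_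
  refine tendsto_integral_filter_of_dominated_convergence
    (fun _ => (m + 1) * ((z / 2) ^ (j + 1))⁻¹) ?_ ?_ (integrable_const _) ?_
  · refine Eventually.of_forall fun w => Measurable.aestronglyMeasurable ?_
    simp only [slope_def_field]
    exact (((measurable_williamsonKernel _ j w).comp hS).sub
      ((measurable_williamsonKernel _ j z).comp hS)).div_const _
  · filter_upwards [hmem] with w hw
    filter_upwards [hS0] with ω hω
    rw [slope_def_field, Real.norm_eq_abs, abs_div, div_le_iff₀ (abs_pos.2 (sub_neg.2 hw.2).ne)]
    exact abs_williamsonKernel_sub_le m j (half_pos hz) hw.1.le (half_le_self hz.le) hω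
  · filter_upwards [hS0] with ω hω
    rw [← hasDerivWithinAt_iff_tendsto_slope' self_notMem_Iio]
    exact hasDerivWithinAt_williamsonKernel m j hω

theorem continuousAt_integral_williamsonKernel (hS : Measurable S) (hS0 : ∀ᵐ ω ∂μ, 0 < S ω)
    (m j : ℕ) {z : ℝ} (hz : 0 < z) :
    ContinuousAt (fun w => ∫ ω, williamsonKernel (m + 1) j w (S ω) ∂μ) z := by
  refine continuousAt_of_dominated (bound := fun _ => ((z / 2) ^ j)⁻¹) ?_ ?_ (integrable_const _) ?_
  · exact Eventually.of_forall fun w =>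
      ((measurable_williamsonKernel _ j w).comp hS).aestronglyMeasurable
  · filter_upwards [Ioi_mem_nhds (half_lt_self hz)] with w hw
    have hw' : z / 2 < w := hw
    filter_upwards [hS0] with ω hω
    refine (abs_williamsonKernel_le _ _ ((half_pos hz).trans hw') hω).trans ?_
    exact inv_anti₀ (by positivity) (pow_le_pow_left₀ (by positivity) hw'.le _)
  · refine ae_of_all _ fun ω => ContinuousAt.div_const ?_ _
    exact ((continuous_truncPow_succ m).comp
      (continuous_const.sub (continuous_id.div_const (S ω)))).continuousAt

/-- At exponent zero the kernel carries the indicator of `w ≤ S`, which tends to that of `z < S` as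
`w` decreases to `z`: the limit loses the atom at `z`. -/
theorem tendsto_integral_williamsonKernel_zero (hS : Measurable S) (hS0 : ∀ᵐ ω ∂μ, 0 < S ω)
    (j : ℕ) {z : ℝ} (hz : 0 < z) :
    Tendsto (fun w => ∫ ω, williamsonKernel 0 j w (S ω) ∂μ) (𝓝[>] z)
      (𝓝 (∫ ω, {ω | z < S ω}.indicator (fun ω => (S ω ^ j)⁻¹) ω ∂μ)) := by
  refine tendsto_integral_filter_of_dominated_convergence (fun _ => (z ^ j)⁻¹) ?_ ?_
    (integrable_const _) ?_
  · exact Eventually.of_forall fun w =>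
      ((measurable_williamsonKernel _ j w).comp hS).aestronglyMeasurable
  · filter_upwards [self_mem_nhdsWithin] with w hw
    have hw' : z < w := hw
    filter_upwards [hS0] with ω hω
    refine (abs_williamsonKernel_le _ _ (hz.trans hw') hω).trans ?_
    exact inv_anti₀ (by positivity) (pow_le_pow_left₀ (by positivity) hw'.le _)
  · filter_upwards [hS0] with ω hω
    refine tendsto_const_nhds.congr' ?_
    by_cases h : z < S ω
    · filter_upwards [mem_nhdsWithin_of_mem_nhds (Iio_mem_nhds h)] with w hw
      rw [williamsonKernel_of_le hω (le_of_lt hw), indicator_of_mem (by exact h)]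
      simp
    · filter_upwards [self_mem_nhdsWithin] with w hw
      rw [williamsonKernel_of_lt hω ((not_lt.1 h).trans_lt hw), indicator_of_notMem (by exact h)]

theorem measureReal_eq_integral_williamsonKernel_sub (hS : Measurable S) (hS0 : ∀ᵐ ω ∂μ, 0 < S ω)
    (j : ℕ) {z : ℝ} (hz : 0 < z) :
    μ.real {ω | S ω = z} = z ^ j * (∫ ω, williamsonKernel 0 j z (S ω) ∂μ -
      ∫ ω, {ω | z < S ω}.indicator (fun ω => (S ω ^ j)⁻¹) ω ∂μ) := by
  have hm : MeasurableSet {ω | z < S ω} := measurableSet_lt measurable_const hS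
  have hint : Integrable ({ω | z < S ω}.indicator (fun ω => (S ω ^ j)⁻¹)) μ := by
    refine Integrable.of_bound
      ((hS.pow_const j).inv.indicator hm).aestronglyMeasurable (z ^ j)⁻¹ (ae_of_all _ fun ω => ?_)
    by_cases h : z < S ω
    · have hω : 0 < S ω := hz.trans h
      rw [indicator_of_mem (by exact h), Real.norm_of_nonneg (by positivity)]
      exact inv_anti₀ (by positivity) (pow_le_pow_left₀ (by positivity) h.le _)
    · rw [indicator_of_notMem (by exact h), norm_zero]
      positivity
  rw [← integral_sub (integrable_williamsonKernel hS hS0 _ _ hz) hint, ← integral_const_mul,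
    ← integral_indicator_one (measurableSet_eq_fun hS measurable_const)]
  refine integral_congr_ae ?_
  filter_upwards [hS0] with ω hω
  rcases lt_trichotomy (S ω) z with h | h | h
  · rw [williamsonKernel_of_lt hω h, indicator_of_notMem (by exact h.ne),
      indicator_of_notMem (by exact not_lt.2 h.le)]
    simp
  · rw [williamsonKernel_of_le hω h.ge, indicator_of_mem (by exact h),
      indicator_of_notMem (by exact not_lt.2 h.le), h]
    have : z ^ j ≠ 0 := by positivity
    simp [this]
  · rw [williamsonKernel_of_le hω h.le, indicator_of_notMem (by exact h.ne'),
      indicator_of_mem (by exact h)]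
    simp

/-- On `{z ≤ S}` the integrands sum to one by the binomial theorem for `z / S + (1 - z / S)`;
elsewhere all of them vanish. -/
theorem measureReal_le_eq_sum_integral_williamsonKernel (hS : Measurable S)
    (hS0 : ∀ᵐ ω ∂μ, 0 < S ω) (n : ℕ) {z : ℝ} (hz : 0 < z) :
    μ.real {ω | z ≤ S ω} = ∑ k ∈ Finset.range (n + 1),
      (n.choose k : ℝ) * z ^ k * ∫ ω, williamsonKernel (n - k) k z (S ω) ∂μ := by
  simp_rw [← integral_const_mul]
  rw [← integral_finsetSum _ fun k _ => (integrable_williamsonKernel hS hS0 _ _ hz).const_mul _,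
    ← integral_indicator_one (measurableSet_le measurable_const hS)]
  refine integral_congr_ae ?_
  filter_upwards [hS0] with ω hω
  rcases lt_or_ge (S ω) z with h | h
  · rw [indicator_of_notMem (by exact not_le.2 h), Finset.sum_eq_zero]
    intro k _
    rw [williamsonKernel_of_lt hω h, mul_zero]
  · rw [indicator_of_mem (by exact h)]
    have := add_pow (z / S ω) (1 - z / S ω) n
    rw [add_sub_cancel, one_pow] at this
    rw [Pi.one_apply, this]
    refine Finset.sum_congr rfl fun k _ => ?_
    rw [williamsonKernel_of_le hω h, div_pow]
    ring

/-- The derivatives of a Williamson transform. -/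
theorem iteratedDeriv_williamson (hS : Measurable S) (hS0 : ∀ᵐ ω ∂μ, 0 < S ω) {n : ℕ} {ψ : ℝ → ℝ}
    (hψ : ∀ z, 0 < z → ψ z = ∫ ω, williamsonKernel n 0 z (S ω) ∂μ) (k : ℕ) (hk : k < n) :
    ∀ z, 0 < z → iteratedDeriv k ψ z =
      (-1) ^ k * n.descFactorial k * ∫ ω, williamsonKernel (n - k) k z (S ω) ∂μ := by
  induction k with
  | zero => intro z hz; simp [hψ z hz]
  | succ k ih =>
    intro z hz
    rw [iteratedDeriv_succ]
    have heq : iteratedDeriv k ψ =ᶠ[𝓝 z] fun z =>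
        (-1) ^ k * n.descFactorial k * ∫ ω, williamsonKernel (n - k) k z (S ω) ∂μ := by
      filter_upwards [Ioi_mem_nhds hz] with w hw using ih (by omega) w hw
    obtain ⟨m, hm⟩ := Nat.exists_eq_add_of_le (show k + 2 ≤ n by omega)
    rw [heq.deriv_eq]
    have h1 : n - k = m + 2 := by omega
    have h2 : n - (k + 1) = m + 1 := by omega
    rw [h1, h2, ((hasDerivAt_integral_williamsonKernel hS hS0 m k hz).const_mul _).deriv,
      Nat.descFactorial_succ, h1]
    push_cast
    ring

theorem hasDerivWithinAt_iteratedDeriv_williamson (hS : Measurable S) (hS0 : ∀ᵐ ω ∂μ, 0 < S ω)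
    {n : ℕ} {ψ : ℝ → ℝ}
    (hψ : ∀ z, 0 < z → ψ z = ∫ ω, williamsonKernel (n + 1) 0 z (S ω) ∂μ) {z : ℝ} (hz : 0 < z) :
    HasDerivWithinAt (iteratedDeriv n ψ) ((-1) ^ (n + 1) * (n + 1).factorial *
      ∫ ω, williamsonKernel 0 (n + 1) z (S ω) ∂μ) (Iio z) z := by
  have hd := iteratedDeriv_williamson hS hS0 hψ n n.lt_succ_self
  simp only [Nat.add_sub_cancel_left] at hd
  refine (((hasDerivWithinAt_integral_williamsonKernel hS hS0 0 n hz).const_mul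
    ((-1) ^ n * ((n + 1).descFactorial n : ℝ))).congr_of_eventuallyEq ?_ (hd z hz)).congr_deriv ?_
  · filter_upwards [mem_nhdsWithin_of_mem_nhds (Ioi_mem_nhds hz)] with w hw using hd w hw
  · rw [show (n + 1).factorial = (n + 1).descFactorial n by
      rw [← Nat.descFactorial_self, Nat.descFactorial_succ]; simp]
    push_cast
    ring

/-- After `k` derivatives the exponent is still one, and the integral is continuous there. -/
theorem contDiffOn_integral_williamsonKernel (hS : Measurable S) (hS0 : ∀ᵐ ω ∂μ, 0 < S ω)
    (k : ℕ) : ∀ j : ℕ, ContDiffOn ℝ k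
      (fun z => ∫ ω, williamsonKernel (k + 1) j z (S ω) ∂μ) (Ioi 0) := by
  induction k with
  | zero =>
    intro j
    rw [Nat.cast_zero, contDiffOn_zero]
    exact fun z hz => (continuousAt_integral_williamsonKernel hS hS0 0 j hz).continuousWithinAt
  | succ k ih =>
    intro j
    rw [Nat.cast_succ, contDiffOn_succ_iff_deriv_of_isOpen isOpen_Ioi]
    refine ⟨fun z hz => (hasDerivAt_integral_williamsonKernel hS hS0 k j
      hz).differentiableAt.differentiableWithinAt, by simp, ?_⟩
    exact (contDiffOn_const.mul (ih (j + 1))).congr fun z hz =>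
      (hasDerivAt_integral_williamsonKernel hS hS0 k j hz).deriv

end Integral

/-! ### Generators and their pseudo-inverses. -/

theorem generatorExt_ofReal (ψ : ℝ → ℝ) {z : ℝ} (hz : 0 ≤ z) :
    generatorExt ψ (ENNReal.ofReal z) = ψ z := by
  simp [generatorExt, ENNReal.toReal_ofReal hz]

namespace IsArchimedeanGenerator

variable {ψ : ℝ → ℝ} (hψ : IsArchimedeanGenerator ψ)
include hψ

/-- Strict monotonicity is assumed only up to the first zero. If `ψ a = 0` the claim is immediate;
otherwise every zero lies beyond `a`. -/
theorem lt_of_lt {a b : ℝ} (hb : 0 ≤ b) (hab : b < a) (hpos : 0 < ψ b) : ψ a < ψ b := by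
  have ha : 0 ≤ a := hb.trans hab.le
  rcases (hψ.mapsTo ha).1.eq_or_lt with h | h
  · rwa [← h]
  · have hle : ENNReal.ofReal a ≤ sInf {z : ℝ≥0∞ | generatorExt ψ z = 0} := by
      refine le_sInf fun w hw => ?_
      rcases eq_or_ne w ∞ with rfl | hw'
      · exact le_top
      · rw [mem_ofPred_eq, generatorExt, if_neg hw'] at hw
        refine ENNReal.ofReal_le_of_le_toReal ?_
        by_contra! hlt
        have := hψ.antitoneOn ENNReal.toReal_nonneg ha hlt.le
        linarith
    have hlt : ENNReal.ofReal b < ENNReal.ofReal a :=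
      (ENNReal.ofReal_lt_ofReal_iff (hb.trans_lt hab)).2 hab
    have := hψ.strictAntiOn ⟨zero_le, hlt.le.trans hle⟩ ⟨zero_le, hle⟩ hlt
    rwa [generatorExt_ofReal ψ hb, generatorExt_ofReal ψ ha] at this

theorem pseudoInv_map {z : ℝ} (hz : 0 ≤ z) (hpos : 0 < ψ z) :
    pseudoInv ψ (ψ z) = ENNReal.ofReal z := by
  refine le_antisymm (sInf_le (generatorExt_ofReal ψ hz)) (le_sInf fun w hw => ?_)
  rcases eq_or_ne w ∞ with rfl | hw'
  · exact le_top
  · rw [mem_ofPred_eq, generatorExt, if_neg hw'] at hw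
    refine ENNReal.ofReal_le_of_le_toReal ?_
    by_contra! hlt
    have := hψ.lt_of_lt ENNReal.toReal_nonneg hlt (hw ▸ hpos)
    linarith

theorem exists_map_eq {t : ℝ} (ht : t ∈ Ioc (0 : ℝ) 1) : ∃ z, 0 ≤ z ∧ ψ z = t := by
  obtain ⟨a, ha, ha0⟩ := ((hψ.tendsto_atTop.eventually (gt_mem_nhds ht.1)).and
    (eventually_ge_atTop 0)).exists
  obtain ⟨z, hz, hzt⟩ := intermediate_value_Icc' ha0
    (hψ.continuousOn.mono Icc_subset_Ici_self) ⟨ha.le, ht.2.trans_eq hψ.map_zero.symm⟩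
  exact ⟨z, hz.1, hzt⟩

theorem pseudoInv_ne_top {t : ℝ} (ht : t ∈ Ioc (0 : ℝ) 1) : pseudoInv ψ t ≠ ∞ := by
  obtain ⟨z, hz, rfl⟩ := hψ.exists_map_eq ht
  rw [hψ.pseudoInv_map hz ht.1]
  exact ENNReal.ofReal_ne_top

theorem map_pseudoInv {t : ℝ} (ht : t ∈ Ioc (0 : ℝ) 1) : ψ (pseudoInv ψ t).toReal = t := by
  obtain ⟨z, hz, rfl⟩ := hψ.exists_map_eq ht
  rw [hψ.pseudoInv_map hz ht.1, ENNReal.toReal_ofReal hz]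

/-- The zero set of `ψ` in `[0, ∞)` is closed, so its infimum is attained. -/
theorem map_pseudoInv_zero (h : pseudoInv ψ 0 ≠ ∞) : ψ (pseudoInv ψ 0).toReal = 0 := by
  set A : Set ℝ := Ici 0 ∩ ψ ⁻¹' {0} with hA
  have hcl : IsClosed A :=
    hψ.continuousOn.preimage_isClosed_of_isClosed isClosed_Ici isClosed_singleton
  have hbdd : BddBelow A := ⟨0, fun z hz => hz.1⟩
  have hne : A.Nonempty := by
    obtain ⟨w, hw, hlt⟩ := sInf_lt_iff.1 (lt_top_iff_ne_top.2 h)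
    rw [mem_ofPred_eq, generatorExt, if_neg hlt.ne] at hw
    exact ⟨w.toReal, ENNReal.toReal_nonneg, hw⟩
  have hmem := hcl.csInf_mem hne hbdd
  have : pseudoInv ψ 0 = ENNReal.ofReal (sInf A) := by
    refine le_antisymm (sInf_le ?_) (le_sInf fun w hw => ?_)
    · rw [mem_ofPred_eq, generatorExt_ofReal ψ hmem.1]
      exact hmem.2
    · rcases eq_or_ne w ∞ with rfl | hw'
      · exact le_top
      · rw [mem_ofPred_eq, generatorExt, if_neg hw'] at hw
        exact ENNReal.ofReal_le_of_le_toReal (csInf_le hbdd ⟨ENNReal.toReal_nonneg, hw⟩)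
  rw [this, ENNReal.toReal_ofReal hmem.1]
  exact hmem.2

theorem pseudoInv_toReal_le_iff {t s : ℝ} (ht : t ∈ Ioc (0 : ℝ) 1) (hs : 0 ≤ s) :
    (pseudoInv ψ t).toReal ≤ s ↔ ψ s ≤ t := by
  have h := hψ.map_pseudoInv ht
  constructor
  · intro hle
    rw [← h]
    exact hψ.antitoneOn ENNReal.toReal_nonneg hs hle
  · intro hle
    by_contra! hlt
    have hts : t ≤ ψ s := h ▸ hψ.antitoneOn hs ENNReal.toReal_nonneg hlt.le
    have := hψ.lt_of_lt hs hlt (ht.1.trans_le hts)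
    rw [h] at this
    linarith

theorem le_pseudoInv_toReal_iff {t s : ℝ} (ht : t ∈ Ioc (0 : ℝ) 1) (hs : 0 ≤ s) :
    s ≤ (pseudoInv ψ t).toReal ↔ t ≤ ψ s := by
  have h := hψ.map_pseudoInv ht
  constructor
  · intro hle
    have := hψ.antitoneOn hs ENNReal.toReal_nonneg hle
    rwa [h] at this
  · intro hle
    by_contra! hlt
    have := hψ.lt_of_lt ENNReal.toReal_nonneg hlt (by rw [h]; exact ht.1)
    linarith

theorem pseudoInv_zero_toReal_le_iff (h : pseudoInv ψ 0 ≠ ∞) {s : ℝ} (hs : 0 ≤ s) :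
    (pseudoInv ψ 0).toReal ≤ s ↔ ψ s ≤ 0 := by
  have h0 := hψ.map_pseudoInv_zero h
  constructor
  · intro hle
    rw [← h0]
    exact hψ.antitoneOn ENNReal.toReal_nonneg hs hle
  · intro hle
    refine ENNReal.toReal_le_of_le_ofReal hs (sInf_le ?_)
    rw [mem_ofPred_eq, generatorExt_ofReal ψ hs]
    exact le_antisymm hle (hψ.mapsTo hs).1

theorem map_pos_of_isStrictGenerator (h : IsStrictGenerator ψ) {s : ℝ} (hs : 0 ≤ s) : 0 < ψ s := by
  refine (hψ.mapsTo hs).1.lt_of_ne' fun h0 => ?_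
  have : pseudoInv ψ 0 ≤ ENNReal.ofReal s := sInf_le (by
    rw [mem_ofPred_eq, generatorExt_ofReal ψ hs, h0])
  rw [h, top_le_iff] at this
  exact ENNReal.ofReal_ne_top this

/-- If some `ψ (a i)` is zero, `φ` need not recover `a i`, but then both sides vanish. -/
theorem generatorExt_sum_pseudoInv {ι : Type*} [Fintype ι] {a : ι → ℝ} (ha : ∀ i, 0 ≤ a i) :
    generatorExt ψ (∑ i, pseudoInv ψ (ψ (a i))) = ψ (∑ i, a i) := by
  by_cases h : ∀ i, 0 < ψ (a i)
  · rw [Finset.sum_congr rfl fun i _ => hψ.pseudoInv_map (ha i) (h i),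
      ← ENNReal.ofReal_sum_of_nonneg fun i _ => ha i,
      generatorExt_ofReal ψ (Finset.sum_nonneg fun i _ => ha i)]
  · push Not at h
    obtain ⟨i, hi⟩ := h
    have hi0 : ψ (a i) = 0 := le_antisymm hi (hψ.mapsTo (ha i)).1
    have hsum : 0 ≤ ∑ i, a i := Finset.sum_nonneg fun i _ => ha i
    have h1 : ψ (∑ i, a i) = 0 := le_antisymm
      ((hψ.antitoneOn (ha i) hsum (Finset.single_le_sum (fun i _ => ha i) (Finset.mem_univ i))).trans
        hi) (hψ.mapsTo hsum).1
    rw [h1, generatorExt]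
    split_ifs with htop
    · rfl
    · have hle : pseudoInv ψ 0 ≤ ∑ i, pseudoInv ψ (ψ (a i)) := by
        rw [← hi0]
        exact Finset.single_le_sum (f := fun i => pseudoInv ψ (ψ (a i))) (fun _ _ => zero_le)
          (Finset.mem_univ i)
      refine le_antisymm ?_ (hψ.mapsTo ENNReal.toReal_nonneg).1
      rw [← hψ.pseudoInv_zero_toReal_le_iff (ne_top_of_le_ne_top htop hle) ENNReal.toReal_nonneg]
      exact ENNReal.toReal_mono htop hle

theorem pseudoInv_toReal_pos {t : ℝ} (ht : t ∈ Ioo (0 : ℝ) 1) : 0 < (pseudoInv ψ t).toReal := by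
  refine ENNReal.toReal_nonneg.lt_of_ne' fun h => ?_
  have := hψ.map_pseudoInv (Ioo_subset_Ioc_self ht)
  rw [h, hψ.map_zero] at this
  exact ht.2.ne' this

theorem pseudoInv_one : pseudoInv ψ 1 = 0 := by
  have := hψ.pseudoInv_map le_rfl (by rw [hψ.map_zero]; exact one_pos)
  simpa [hψ.map_zero] using this

theorem tendsto_pseudoInv_toReal {t : ℝ} (ht : t ∈ Ioc (0 : ℝ) 1) :
    Tendsto (fun s => (pseudoInv ψ s).toReal) (𝓝[<] t) (𝓝[>] (pseudoInv ψ t).toReal) := by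
  set z := (pseudoInv ψ t).toReal with hz
  have hz0 : 0 ≤ z := ENNReal.toReal_nonneg
  have hmem : ∀ᶠ s in 𝓝[<] t, s ∈ Ioc (0 : ℝ) 1 ∧ s < t := by
    filter_upwards [mem_nhdsWithin_of_mem_nhds (Ioi_mem_nhds ht.1), self_mem_nhdsWithin]
      with s hs hs'
    exact ⟨⟨hs, (le_of_lt hs').trans ht.2⟩, hs'⟩
  have hgt : ∀ᶠ s in 𝓝[<] t, z < (pseudoInv ψ s).toReal := by
    filter_upwards [hmem] with s hs
    rw [← not_le, hψ.pseudoInv_toReal_le_iff hs.1 hz0, not_le, hz, hψ.map_pseudoInv ht]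
    exact hs.2
  refine tendsto_nhdsWithin_iff.2 ⟨?_, hgt⟩
  refine tendsto_order.2 ⟨fun a ha => hgt.mono fun s hs => ha.trans hs, fun b hb => ?_⟩
  obtain ⟨w, hzw, hwb⟩ := exists_between hb
  have hlt : ψ w < t := by
    rw [← hψ.map_pseudoInv ht]
    exact hψ.lt_of_lt hz0 hzw (by rw [hψ.map_pseudoInv ht]; exact ht.1)
  filter_upwards [hmem, mem_nhdsWithin_of_mem_nhds (Ioi_mem_nhds hlt)] with s hs hs'
  exact ((hψ.pseudoInv_toReal_le_iff hs.1 (hz0.trans hzw.le)).2 (le_of_lt hs')).trans_lt hwb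

end IsArchimedeanGenerator

/-! ### The copula in the coordinates `φ(x i)`. -/

/-- The real-valued pseudo-inverse on the unit interval, with value `0` at `0`. -/
noncomputable def pseudoInvReal (ψ : ℝ → ℝ) (x : unitInterval) : ℝ :=
  -- Uniform marginals do not charge `0`, so this value affects null sets only.
  if x = 0 then 0 else (pseudoInv ψ x).toReal

theorem pseudoInvReal_nonneg (ψ : ℝ → ℝ) (x : unitInterval) : 0 ≤ pseudoInvReal ψ x := by
  rw [pseudoInvReal]
  split_ifs
  · rfl
  · exact ENNReal.toReal_nonneg

theorem unitInterval_mem_Ioc {x : unitInterval} (hx : x ≠ 0) : (x : ℝ) ∈ Ioc (0 : ℝ) 1 :=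
  ⟨unitInterval.pos_iff_ne_zero.2 hx, x.2.2⟩

theorem measurable_pseudoInvReal {ψ : ℝ → ℝ} (hψ : IsArchimedeanGenerator ψ) :
    Measurable (pseudoInvReal ψ) := by
  refine measurable_of_Ici fun a => ?_
  rcases le_or_gt a 0 with ha | ha
  · convert MeasurableSet.univ
    exact eq_univ_of_forall fun x => ha.trans (pseudoInvReal_nonneg ψ x)
  · have : pseudoInvReal ψ ⁻¹' Ici a = {x | x ≠ 0} ∩ {x : unitInterval | (x : ℝ) ≤ ψ a} := by
      ext x
      simp only [mem_preimage, mem_Ici, mem_inter_iff, mem_ofPred_eq]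
      by_cases hx : x = 0
      · simp [pseudoInvReal, hx, ha]
      · rw [pseudoInvReal, if_neg hx, hψ.le_pseudoInv_toReal_iff (unitInterval_mem_Ioc hx) ha.le]
        simp [hx]
    rw [this]
    exact (measurableSet_singleton 0).compl.inter
      (measurableSet_le measurable_subtype_coe measurable_const)

namespace IsCopulaWithMeasure

variable {d : ℕ} {C : (Fin d → unitInterval) → ℝ} {μ : Measure (Fin d → unitInterval)}

theorem ae_ne (hC : IsCopulaWithMeasure C μ) (i : Fin d) (c : unitInterval) :
    ∀ᵐ x ∂μ, x i ≠ c := by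
  have h : μ.map (fun x => x i) {c} = 0 := by rw [hC.map_eval]; exact measure_singleton c
  rw [Measure.map_apply (measurable_pi_apply i) (measurableSet_singleton c)] at h
  exact measure_eq_zero_iff_ae_notMem.1 h

theorem ae_forall_ne_zero (hC : IsCopulaWithMeasure C μ) : ∀ᵐ x ∂μ, ∀ i, x i ≠ 0 :=
  ae_all_iff.2 fun i => hC.ae_ne i 0

variable {ψ : ℝ → ℝ}

/-- Since `a i ≤ φ(x i)` iff `x i ≤ ψ (a i)`, the orthant event is almost surely the box on which
`C` is evaluated. -/
theorem measureReal_le_pseudoInvReal (hC : IsCopulaWithMeasure C μ)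
    (hψ : IsArchimedeanGenerator ψ) (hCψ : ∀ x, C x = archimedeanFun d ψ x) (a : Fin d → ℝ)
    (ha : ∀ i, 0 ≤ a i) :
    μ.real {x | ∀ i, a i ≤ pseudoInvReal ψ (x i)} = ψ (∑ i, a i) := by
  rw [← hψ.generatorExt_sum_pseudoInv ha]
  refine Eq.trans ?_ ((hC.real_Iic fun i => ⟨ψ (a i), hψ.mapsTo (ha i)⟩).trans (hCψ _))
  refine measureReal_congr ?_
  filter_upwards [hC.ae_forall_ne_zero] with x hx
  refine propext (forall_congr' fun i => ?_)
  rw [pseudoInvReal, if_neg (hx i), hψ.le_pseudoInv_toReal_iff (unitInterval_mem_Ioc (hx i)) (ha i)]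
  rfl

theorem ae_eq_map_sum (hC : IsCopulaWithMeasure C μ)
    (hψ : IsArchimedeanGenerator ψ) (hCψ : ∀ x, C x = archimedeanFun d ψ x) :
    ∀ᵐ x ∂μ, C x = ψ (∑ i, pseudoInvReal ψ (x i)) := by
  filter_upwards [hC.ae_forall_ne_zero] with x hx
  have h : ∀ i, pseudoInv ψ (x i) ≠ ∞ := fun i => hψ.pseudoInv_ne_top (unitInterval_mem_Ioc (hx i))
  rw [hCψ, archimedeanFun, generatorExt, if_neg (ENNReal.sum_ne_top.2 fun i _ => h i),
    ENNReal.toReal_sum fun i _ => h i]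
  simp [pseudoInvReal, hx]

theorem ae_sum_pos (hC : IsCopulaWithMeasure C μ) (hψ : IsArchimedeanGenerator ψ) (hd : 0 < d) :
    ∀ᵐ x ∂μ, 0 < ∑ i, pseudoInvReal ψ (x i) := by
  filter_upwards [hC.ae_ne ⟨0, hd⟩ 0, hC.ae_ne ⟨0, hd⟩ 1] with x h0 h1
  refine Finset.sum_pos' (fun i _ => pseudoInvReal_nonneg ψ _) ⟨⟨0, hd⟩, Finset.mem_univ _, ?_⟩
  rw [pseudoInvReal, if_neg h0]
  exact hψ.pseudoInv_toReal_pos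
    ⟨unitInterval.pos_iff_ne_zero.2 h0, unitInterval.lt_one_iff_ne_one.2 h1⟩

end IsCopulaWithMeasure

/-! ### Inverting the Williamson transform. -/

section Williamson

variable {Ω : Type*} [MeasurableSpace Ω] {μ : Measure Ω} [IsFiniteMeasure μ] {S : Ω → ℝ}
  {n : ℕ} {ψ : ℝ → ℝ}

theorem leftDeriv_iteratedDeriv_williamson (hS : Measurable S) (hS0 : ∀ᵐ ω ∂μ, 0 < S ω)
    (hψ : ∀ z, 0 < z → ψ z = ∫ ω, williamsonKernel (n + 1) 0 z (S ω) ∂μ) {z : ℝ} (hz : 0 < z) :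
    leftDeriv (iteratedDeriv n ψ) z =
      (-1) ^ (n + 1) * (n + 1).factorial * ∫ ω, williamsonKernel 0 (n + 1) z (S ω) ∂μ :=
  (hasDerivWithinAt_iteratedDeriv_williamson hS hS0 hψ hz).derivWithin (uniqueDiffWithinAt_Iio z)

/-- The tail of a law in terms of its Williamson transform. -/
theorem measureReal_le_eq_leftDeriv_add_sum (hS : Measurable S) (hS0 : ∀ᵐ ω ∂μ, 0 < S ω)
    (hψ : ∀ z, 0 < z → ψ z = ∫ ω, williamsonKernel (n + 1) 0 z (S ω) ∂μ) {z : ℝ} (hz : 0 < z) :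
    μ.real {ω | z ≤ S ω} =
      leftDeriv (iteratedDeriv n ψ) z * ((-1) ^ (n + 1) / ((n + 1).factorial : ℝ)) * z ^ (n + 1) +
        ∑ k ∈ Finset.range (n + 1),
          iteratedDeriv k ψ z * ((-1) ^ k / (k.factorial : ℝ)) * z ^ k := by
  have hsq : ∀ k : ℕ, ((-1 : ℝ) ^ k) * (-1) ^ k = 1 := fun k => by rw [← mul_pow]; simp
  rw [measureReal_le_eq_sum_integral_williamsonKernel hS hS0 (n + 1) hz, Finset.sum_range_succ,
    add_comm]
  congr 1
  · rw [leftDeriv_iteratedDeriv_williamson hS hS0 hψ hz, Nat.choose_self, Nat.sub_self]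
    have : ((n + 1).factorial : ℝ) ≠ 0 := by positivity
    field_simp
    linear_combination (-(∫ ω, williamsonKernel 0 (n + 1) z (S ω) ∂μ)) * hsq (n + 1)
  · refine Finset.sum_congr rfl fun k hk => ?_
    rw [iteratedDeriv_williamson hS hS0 hψ k (Finset.mem_range.1 hk) z hz,
      Nat.descFactorial_eq_factorial_mul_choose]
    have : (k.factorial : ℝ) ≠ 0 := by positivity
    push_cast
    field_simp
    linear_combination
      (-((n + 1).choose k * ∫ ω, williamsonKernel (n + 1 - k) k z (S ω) ∂μ)) * hsq k

/-- The derivatives of a Williamson transform vanish where it does. -/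
theorem iteratedDeriv_williamson_eq_zero (hS : Measurable S) (hS0 : ∀ᵐ ω ∂μ, 0 < S ω)
    (hψ : ∀ z, 0 < z → ψ z = ∫ ω, williamsonKernel (n + 1) 0 z (S ω) ∂μ) {z : ℝ} (hz : 0 < z)
    (h0 : ψ z = 0) {k : ℕ} (hk : k < n + 1) : iteratedDeriv k ψ z = 0 := by
  have hnn : 0 ≤ᵐ[μ] fun ω => williamsonKernel (n + 1) 0 z (S ω) :=
    hS0.mono fun ω hω => div_nonneg (truncPow_nonneg _ _) (pow_nonneg hω.le _)
  rw [hψ z hz, integral_eq_zero_iff_of_nonneg_ae hnn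
    (integrable_williamsonKernel hS hS0 _ _ hz)] at h0
  rw [iteratedDeriv_williamson hS hS0 hψ k hk z hz, integral_eq_zero_of_ae, mul_zero]
  filter_upwards [h0] with ω hω
  obtain ⟨m, hm⟩ := Nat.exists_eq_add_of_lt hk
  rw [show n + 1 - k = m + 1 by omega]
  simp only [williamsonKernel, pow_zero, div_one, Pi.zero_apply, truncPow_succ_eq] at hω ⊢
  rw [pow_eq_zero_iff n.succ_ne_zero] at hω
  rw [hω, zero_pow m.succ_ne_zero, zero_div]

/-- The right limit in `z` is what `D⁻ψ^(d-2)(φ(t-))` becomes, since `φ(s)` decreases to `φ(t)` as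
`s` increases to `t`. -/
theorem tendsto_leftDeriv_iteratedDeriv_williamson (hS : Measurable S) (hS0 : ∀ᵐ ω ∂μ, 0 < S ω)
    (hψ : ∀ z, 0 < z → ψ z = ∫ ω, williamsonKernel (n + 1) 0 z (S ω) ∂μ) {z : ℝ} (hz : 0 < z) :
    Tendsto (leftDeriv (iteratedDeriv n ψ)) (𝓝[>] z) (𝓝 ((-1) ^ (n + 1) * (n + 1).factorial *
      ∫ ω, {ω | z < S ω}.indicator (fun ω => (S ω ^ (n + 1))⁻¹) ω ∂μ)) := by
  refine ((tendsto_integral_williamsonKernel_zero hS hS0 (n + 1) hz).const_mul _).congr' ?_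
  filter_upwards [self_mem_nhdsWithin] with w hw
  exact (leftDeriv_iteratedDeriv_williamson hS hS0 hψ (hz.trans hw)).symm

end Williamson

/-! ### Level sets and the Kendall distribution function. -/

theorem mainTheorem11 (d : ℕ) (hd : 3 ≤ d)
    (C : (Fin d → unitInterval) → ℝ) (μ : Measure (Fin d → unitInterval))
    (hC : IsCopulaWithMeasure C μ)
    (ψ : ℝ → ℝ) (hψ : IsArchimedeanGenerator ψ) (hCψ : ∀ x, C x = archimedeanFun d ψ x) :
    -- all derivatives and one-sided limits in the formulas below exist
    (ContDiffOn ℝ ((d - 2 : ℕ) : WithTop ℕ∞) ψ (Ioi 0) ∧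
      (∀ z : ℝ, 0 < z → DifferentiableWithinAt ℝ (iteratedDeriv (d - 2) ψ) (Iio z) z) ∧
      (∀ t ∈ Ioo (0 : ℝ) 1, ∃ l : ℝ,
        Tendsto (fun s : ℝ => leftDeriv (iteratedDeriv (d - 2) ψ) (pseudoInv ψ s).toReal)
          (𝓝[<] t) (𝓝 l)) ∧
      (∀ t ∈ Ioc (0 : ℝ) 1, pseudoInv ψ t ≠ ∞)) ∧
    -- masses of the level sets; at `t = 1` the prefactor is zero
    (∀ t ∈ Ioc (0 : ℝ) 1,
      μ.real (levelSet C t) =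
        (-(pseudoInv ψ t).toReal) ^ (d - 1) / ((d - 1).factorial : ℝ) *
          (leftDeriv (iteratedDeriv (d - 2) ψ) (pseudoInv ψ t).toReal -
            Function.leftLim
              (fun s : ℝ => leftDeriv (iteratedDeriv (d - 2) ψ) (pseudoInv ψ s).toReal) t)) ∧
    (IsStrictGenerator ψ → μ.real (levelSet C 0) = 0) ∧
    (¬ IsStrictGenerator ψ →
      μ.real (levelSet C 0) =
        (-(pseudoInv ψ 0).toReal) ^ (d - 1) / ((d - 1).factorial : ℝ) *
          leftDeriv (iteratedDeriv (d - 2) ψ) (pseudoInv ψ 0).toReal) ∧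
    -- the Kendall distribution function
    (∀ t ∈ Ioc (0 : ℝ) 1,
      kendallFun C μ t =
        leftDeriv (iteratedDeriv (d - 2) ψ) (pseudoInv ψ t).toReal *
            ((-1) ^ (d - 1) / ((d - 1).factorial : ℝ)) * (pseudoInv ψ t).toReal ^ (d - 1) +
          ∑ k ∈ Finset.range (d - 1),
            iteratedDeriv k ψ (pseudoInv ψ t).toReal * ((-1) ^ k / (k.factorial : ℝ)) *
              (pseudoInv ψ t).toReal ^ k) ∧
    (IsStrictGenerator ψ → kendallFun C μ 0 = 0) ∧
    (¬ IsStrictGenerator ψ →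
      kendallFun C μ 0 =
        leftDeriv (iteratedDeriv (d - 2) ψ) (pseudoInv ψ 0).toReal *
          ((-1) ^ (d - 1) / ((d - 1).factorial : ℝ)) * (pseudoInv ψ 0).toReal ^ (d - 1)) := by
  obtain ⟨n, rfl⟩ := Nat.exists_eq_add_of_le' (show 2 ≤ d by omega)
  have hn : 0 < n := by omega
  simp only [show n + 2 - 2 = n from rfl, show n + 2 - 1 = n + 1 from rfl]
  have := hC.isProbabilityMeasure
  set S : (Fin (n + 2) → unitInterval) → ℝ := fun x => ∑ i, pseudoInvReal ψ (x i) with hSdef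
  have hZm : Measurable fun (x : Fin (n + 2) → unitInterval) i => pseudoInvReal ψ (x i) :=
    measurable_pi_lambda _ fun i => (measurable_pseudoInvReal hψ).comp (measurable_pi_apply i)
  have hS : Measurable S :=
    Finset.measurable_sum _ fun i _ => (measurable_pseudoInvReal hψ).comp (measurable_pi_apply i)
  have hSnn : ∀ x, 0 ≤ S x := fun x => Finset.sum_nonneg fun i _ => pseudoInvReal_nonneg ψ _
  have hS0 : ∀ᵐ x ∂μ, 0 < S x := hC.ae_sum_pos hψ (by omega)
  have hCS : ∀ᵐ x ∂μ, C x = ψ (S x) := hC.ae_eq_map_sum hψ hCψ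
  have hW : ∀ z, 0 < z → ψ z = ∫ x, williamsonKernel (n + 1) 0 z (S x) ∂μ := by
    intro z hz
    rw [eq_integral_williamson (Nat.succ_pos n) hZm (fun x i => pseudoInvReal_nonneg ψ (x i)) hS0
      (hC.measureReal_le_pseudoInvReal hψ hCψ) hz]
    simp only [williamsonKernel, truncPow_succ_eq, pow_zero, div_one, hSdef]
  have hlim : ∀ t ∈ Ioo (0 : ℝ) 1, Tendsto
      (fun s : ℝ => leftDeriv (iteratedDeriv n ψ) (pseudoInv ψ s).toReal) (𝓝[<] t) _ := fun t ht =>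
    (tendsto_leftDeriv_iteratedDeriv_williamson hS hS0 hW (hψ.pseudoInv_toReal_pos ht)).comp
      (hψ.tendsto_pseudoInv_toReal (Ioo_subset_Ioc_self ht))
  have hK0 : μ.real (levelSet C 0) = kendallFun C μ 0 := by
    refine congrArg μ.real (Set.ext fun x => ?_)
    have hx : 0 ≤ C x := hC.real_Iic x ▸ measureReal_nonneg
    exact ⟨fun h => le_of_eq h, fun h => le_antisymm h hx⟩
  have hstrict : IsStrictGenerator ψ → kendallFun C μ 0 = 0 := by
    intro hs
    rw [kendallFun, measureReal_def, measure_eq_zero_iff_ae_notMem.2, ENNReal.toReal_zero]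
    filter_upwards [hCS] with x hx hx'
    change C x ≤ 0 at hx'
    rw [hx] at hx'
    exact not_lt.2 hx' (hψ.map_pos_of_isStrictGenerator hs (hSnn x))
  have hnonstrict : ¬ IsStrictGenerator ψ → kendallFun C μ 0 =
      leftDeriv (iteratedDeriv n ψ) (pseudoInv ψ 0).toReal *
        ((-1) ^ (n + 1) / ((n + 1).factorial : ℝ)) * (pseudoInv ψ 0).toReal ^ (n + 1) := by
    intro hs
    have h0 := hψ.map_pseudoInv_zero hs
    have hz : 0 < (pseudoInv ψ 0).toReal := by
      refine ENNReal.toReal_nonneg.lt_of_ne' fun h => ?_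
      rw [h, hψ.map_zero] at h0
      exact one_ne_zero h0
    have hset : kendallFun C μ 0 = μ.real {x | (pseudoInv ψ 0).toReal ≤ S x} := by
      refine measureReal_congr ?_
      filter_upwards [hCS] with x hx
      refine propext (?_ : C x ≤ 0 ↔ (pseudoInv ψ 0).toReal ≤ S x)
      rw [hx]
      exact (hψ.pseudoInv_zero_toReal_le_iff hs (hSnn x)).symm
    -- As `ψ(φ(0)) = 0`, the lower derivatives vanish at `φ(0)`, and only the left-derivative term
    -- survives.
    rw [hset, measureReal_le_eq_leftDeriv_add_sum hS hS0 hW hz, Finset.sum_eq_zero, add_zero]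
    intro k hk
    rw [iteratedDeriv_williamson_eq_zero hS hS0 hW hz h0 (Finset.mem_range.1 hk), zero_mul,
      zero_mul]
  refine ⟨⟨?_, ?_, fun t ht => ⟨_, hlim t ht⟩, fun t ht => hψ.pseudoInv_ne_top ht⟩, ?_,
    fun hs => hK0.trans (hstrict hs), fun hs => ?_, ?_, hstrict, hnonstrict⟩
  · exact (contDiffOn_integral_williamsonKernel hS hS0 n 0).congr hW
  · exact fun z hz => (hasDerivWithinAt_iteratedDeriv_williamson hS hS0 hW hz).differentiableWithinAt
  · intro t ht
    rcases ht.2.eq_or_lt with rfl | ht1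
    -- At `t = 1` the zero prefactor absorbs the left derivative and left limit, whatever their
    -- values; `S > 0` gives `C < 1` almost surely.
    · rw [hψ.pseudoInv_one, ENNReal.toReal_zero, neg_zero, zero_pow n.succ_ne_zero, zero_div,
        zero_mul, measureReal_def, measure_eq_zero_iff_ae_notMem.2, ENNReal.toReal_zero]
      filter_upwards [hCS, hS0] with x hx hx0 hx'
      have h1 := hψ.lt_of_lt le_rfl hx0 (by rw [hψ.map_zero]; exact one_pos)
      rw [hψ.map_zero, ← hx] at h1
      exact h1.ne hx'
    · have hz := hψ.pseudoInv_toReal_pos ⟨ht.1, ht1⟩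
      have hset : μ.real (levelSet C t) = μ.real {x | S x = (pseudoInv ψ t).toReal} := by
        refine measureReal_congr ?_
        filter_upwards [hCS] with x hx
        refine propext (?_ : C x = t ↔ S x = (pseudoInv ψ t).toReal)
        rw [hx, le_antisymm_iff,
          le_antisymm_iff (a := S x), ← hψ.pseudoInv_toReal_le_iff ht (hSnn x),
          ← hψ.le_pseudoInv_toReal_iff ht (hSnn x), and_comm]
      rw [hset, measureReal_eq_integral_williamsonKernel_sub hS hS0 (n + 1) hz,
        leftLim_eq_of_tendsto (hlim t ⟨ht.1, ht1⟩),
        leftDeriv_iteratedDeriv_williamson hS hS0 hW hz, neg_pow]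
      have : ((n + 1).factorial : ℝ) ≠ 0 := by positivity
      have hsq : ((-1 : ℝ) ^ (n + 1)) ^ 2 = 1 := by rw [← pow_mul, mul_comm, pow_mul]; simp
      field_simp
      rw [hsq]
      ring
  · rw [hK0, hnonstrict hs, neg_pow]
    ring
  · intro t ht
    rcases ht.2.eq_or_lt with rfl | ht1
    -- At `t = 1` only the term `k = 0`, equal to `ψ 0 = 1`, remains.
    · rw [hψ.pseudoInv_one, ENNReal.toReal_zero, zero_pow n.succ_ne_zero, mul_zero, zero_add,
        Finset.sum_range_succ', Finset.sum_eq_zero fun k _ => by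
          rw [zero_pow k.succ_ne_zero, mul_zero]]
      have : {x | C x ≤ 1} = univ :=
        eq_univ_of_forall fun x => by rw [mem_ofPred_eq, ← hC.real_Iic x]; exact measureReal_le_one
      simp [kendallFun, this, hψ.map_zero]
    · rw [← measureReal_le_eq_leftDeriv_add_sum hS hS0 hW (hψ.pseudoInv_toReal_pos ⟨ht.1, ht1⟩)]
      refine measureReal_congr ?_
      filter_upwards [hCS] with x hx
      refine propext (?_ : C x ≤ t ↔ (pseudoInv ψ t).toReal ≤ S x)
      rw [hx]
      exact (hψ.pseudoInv_toReal_le_iff ht (hSnn x)).symm
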